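/- Let $\mathcal{E}$ be a category with terminal object $1$. A \emph{clan structure} on $\mathcal{E}$ is a class of maps, called fibrations, that contains the isomorphisms and all maps $X\to 1$, is closed under composition, and is closed under base change (pullbacks of fibrations along arbitrary maps exist and are fibrations). For $B\in\mathcal{E}$, let $\mathcal{E}(B)$ be the full subcategory of $\mathcal{E}/B$ whose objects are the fibrations $X\to B$, with the maps whose underlying map is a fibration as its fibrations. A map of a clan is \emph{anodyne} if it has the left lifting property with respect to all fibrations. A clan is a \emph{tribe} if every map factors as an anodyne map followed by a fibration and the base change of an anodyne map along a fibration is anodyne. A tribe is a \emph{$\pi$-tribe} if for all fibrations $p:X\to A$ and $f:A\to B$ there is an object $\Pi_f(X,p)$ of $\mathcal{E}/B$ with an evaluation $f^\star\Pi_f(X,p)\to (X,p)$ cofree with respect to $f^\star:\mathcal{E}/B\to\mathcal{E}/A$ (an internal product), its structure map to $B$ is a fibration, and the resulting functor $\Pi_f:\mathcal{E}(A)\to\mathcal{E}(B)$ takes anodyne maps to anodyne maps. In a tribe, a \emph{path object} for $A$ is a factorization of the diagonal $A\to A\times A$ as an anodyne map $\sigma:A\to PA$ followed by a fibration $(\partial_0,\partial_1):PA\to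 A\times A$. Maps $f,g:X\to A$ are \emph{homotopic} if there is $h:X\to PA$, for a path object $PA$, with $\partial_0h=f$ and $\partial_1h=g$; a \emph{homotopy equivalence} is a map with a two-sided inverse up to homotopy. An object $A$ is \emph{contractible} if $A\to 1$ is a homotopy equivalence, \emph{inhabited} if there is a map $1\to A$, and a \emph{mere proposition} if $A\to 1$ is homotopy monic. Here $u:A\to B$ is \emph{homotopy monic} if the square with sides $1_A,1_A,u,u$ is homotopy cartesian; a commutative square $vg=fu$ with $u:C\to A$, $g:C\to D$, $f:A\to B$, $v:D\to B$ is \emph{homotopy cartesian} if $v=v_1v_0$ for some homotopy equivalence $v_0:D\to D'$ and some fibration $v_1:D'\to B$ such that $(u,v_0g):C\to A\times_B D'$ is a homotopy equivalence. \textbf{Proposition (Voevodsky).} Let $\mathcal{E}$ be a $\pi$-tribe and let $A\in\mathcal{E}$. Then there are a path object $PA$ for $A$ and an internal product $\Pi_{p_1}(PA)$ of $(\partial_0,\partial_1):PA\to A\times A$ along the first projection $p_1:A\times A\to A$. For every choice of these, let $$isCont(A):=\Sigma_A\Pi_{p_1}(PA)=\sum_{x_1:A}\ \prod_{x_2:A}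 x_1=_A x_2$$ be the object of $\mathcal{E}$ underlying the object $\Pi_{p_1}(PA)$ of $\mathcal{E}/A$. Then $isCont(A)$ is a mere proposition, and $A$ is contractible if and only if $isCont(A)$ is inhabited. -/

import Mathlib

open CategoryTheory CategoryTheory.Limits

universe v u

namespace Tribes

/-! ## Clans -/

/-- A clan structure on a category with terminal object: a class of maps, the fibrations, which
contains the isomorphisms, is closed under composition and under base change (in particular every
fibration is carrable), and contains the map `X ⟶ 1` for every object `X`. -/
class Clan (E : Type u) [Category.{v} E] [HasTerminal E] where
  /-- the class of fibrations -/
  fib : MorphismProperty E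
  fib_of_isIso : ∀ {X Y : E} (f : X ⟶ Y), IsIso f → fib f
  fib_comp : ∀ {X Y Z : E} (f : X ⟶ Y) (g : Y ⟶ Z), fib f → fib g → fib (f ≫ g)
  carrable : ∀ {X B : E} {p : X ⟶ B}, fib p → HasPullbacksAlong p
  fib_baseChange : ∀ {Q A X B : E} {p₁ : Q ⟶ A} {p₂ : Q ⟶ X} {f : A ⟶ B} {p : X ⟶ B},
    IsPullback p₁ p₂ f p → fib p → fib p₁
  fib_terminal : ∀ X : E, fib (terminal.from X)

open Clan

section Clans

variable {E : Type u} [Category.{v} E] [HasTerminal E] [Clan E]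

/-- A clan has binary products. -/
instance hasBinaryProducts : HasBinaryProducts E := by
  have key : ∀ X Y : E, HasBinaryProduct X Y := fun X Y => by
    have : HasPullback (terminal.from X) (terminal.from Y) :=
      carrable (fib_terminal Y) (terminal.from X)
    exact ⟨⟨⟨_, isProductOfIsTerminalIsPullback _ _ _ _ terminalIsTerminal
      (pullbackIsPullback (terminal.from X) (terminal.from Y))⟩⟩⟩
  exact hasBinaryProducts_of_hasLimit_pair E

/-- The first projection `A × B ⟶ A` is a fibration. -/
theorem fib_fst (A B : E) : fib (prod.fst : A ⨯ B ⟶ A) :=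
  fib_baseChange (IsPullback.of_hasBinaryProduct' A B) (fib_terminal B)

/-- The base change functor `f^* : E/B ⥤ E/A` along a fibration `f : A ⟶ B`. -/
noncomputable abbrev baseChange {A B : E} {f : A ⟶ B} (hf : fib f) : Over B ⥤ Over A :=
  haveI : HasPullbacksAlong f := carrable hf
  Over.pullback f

/-- The local clan `E(B)`: the full subcategory of `E/B` whose objects are the fibrations. -/
abbrev LocalClan (B : E) : Type max u v :=
  ObjectProperty.FullSubcategory (fun X : Over B => fib X.hom)

/-- The fibrations of the local clan `E(B)`: the maps whose underlying map is a fibration. -/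
def localFib (B : E) : MorphismProperty (LocalClan B) :=
  fun _ _ u => fib u.hom.left

/-- A map of a clan is anodyne if it has the left lifting property with respect to every
fibration. -/
def Anodyne {X Y : E} (u : X ⟶ Y) : Prop :=
  (fib : MorphismProperty E).llp u

/-- The anodyne maps of the local clan `E(B)`. -/
def LocalAnodyne {B : E} {X Y : LocalClan B} (u : X ⟶ Y) : Prop :=
  (localFib B).llp u

/-- An internal product of `X : E/A` along a fibration `f : A ⟶ B`: an object of `E/B` together
with an evaluation map `ev`, cofree with respect to the base change functor `E/B ⥤ E/A`. -/
structure InternalProduct {A B : E} {f : A ⟶ B} (hf : fib f) (X : Over A) where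
  /-- the object `Π_f X` of `E/B` -/
  obj : Over B
  /-- the evaluation `f^* (Π_f X) ⟶ X` -/
  ev : (baseChange hf).obj obj ⟶ X
  cofree : ∀ C : Over B,
    Function.Bijective (fun w : C ⟶ obj => (baseChange hf).map w ≫ ev)

/-- The unique map `C ⟶ Π_f X` whose transpose is `t : f^* C ⟶ X`. -/
noncomputable def InternalProduct.lam {A B : E} {f : A ⟶ B} {hf : fib f} {X : Over A}
    (P : InternalProduct hf X) {C : Over B} (t : (baseChange hf).obj C ⟶ X) : C ⟶ P.obj :=
  ((P.cofree C).surjective t).choose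

/-- The action of the functor `Π_f` on a map `u : X ⟶ Y` of `E/A`: the unique map
`w : Π_f X ⟶ Π_f Y` such that `f^*(w)` followed by the evaluation is the evaluation followed
by `u`. -/
noncomputable def InternalProduct.map {A B : E} {f : A ⟶ B} {hf : fib f} {X Y : Over A}
    (P : InternalProduct hf X) (Q : InternalProduct hf Y) (u : X ⟶ Y) : P.obj ⟶ Q.obj :=
  Q.lam (P.ev ≫ u)

end Clans

/-! ## Tribes and π-tribes -/

/-- A clan is a tribe if every map is an anodyne map followed by a fibration, and the base change
of an anodyne map along a fibration is anodyne. -/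
class IsTribe (E : Type u) [Category.{v} E] [HasTerminal E] [Clan E] : Prop where
  factor : ∀ {X Y : E} (f : X ⟶ Y),
    ∃ (Z : E) (i : X ⟶ Z) (p : Z ⟶ Y), i ≫ p = f ∧ Anodyne i ∧ fib p
  anodyne_baseChange : ∀ {Q A X B : E} {i' : Q ⟶ A} {p' : Q ⟶ X} {p : A ⟶ B} {i : X ⟶ B},
    IsPullback i' p' p i → fib p → Anodyne i → Anodyne i'

/-- A clan is a π-clan if every fibration `p : X ⟶ A` has an internal product along every
fibration `f : A ⟶ B`, whose structure map to `B` is a fibration. -/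
def IsPiClan (E : Type u) [Category.{v} E] [HasTerminal E] [Clan E] : Prop :=
  ∀ {X A B : E} {f : A ⟶ B} (hf : fib f) (p : X ⟶ A), fib p →
    ∃ P : InternalProduct hf (Over.mk p), fib P.obj.hom

/-- A π-tribe: a tribe which is a π-clan and in which the internal product functor
`Π_f : E(A) ⥤ E(B)` along any fibration `f : A ⟶ B` takes anodyne maps to anodyne maps. -/
class IsPiTribe (E : Type u) [Category.{v} E] [HasTerminal E] [Clan E] : Prop
    extends IsTribe E where
  isPiClan : IsPiClan E
  anodyne_map : ∀ {A B : E} {f : A ⟶ B} (hf : fib f) {X Y : LocalClan A} (u : X ⟶ Y)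
    (P : InternalProduct hf X.obj) (Q : InternalProduct hf Y.obj)
    (hP : fib P.obj.hom) (hQ : fib Q.obj.hom), LocalAnodyne u →
    LocalAnodyne (B := B) (X := ⟨P.obj, hP⟩) (Y := ⟨Q.obj, hQ⟩)
      (ObjectProperty.homMk (P.map Q u.hom))

/-! ## Homotopy in a tribe -/

section Homotopy

variable {E : Type u} [Category.{v} E] [HasTerminal E] [Clan E]

/-- A path object for `A`: a factorization of the diagonal `A ⟶ A × A` as an anodyne map `σ`
followed by a fibration `(∂₀, ∂₁)`. -/
structure PathObject (A : E) where
  /-- the object `PA` -/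
  obj : E
  /-- the source `∂₀` -/
  d₀ : obj ⟶ A
  /-- the target `∂₁` -/
  d₁ : obj ⟶ A
  /-- the constant path map `σ` -/
  σ : A ⟶ obj
  fac : σ ≫ prod.lift d₀ d₁ = prod.lift (𝟙 A) (𝟙 A)
  anodyne_σ : Anodyne σ
  fib_lift : fib (prod.lift d₀ d₁)

/-- `PA` as an object of `E/(A × A)`, with structure map `(∂₀, ∂₁)`. -/
noncomputable def PathObject.over {A : E} (P : PathObject A) : Over (A ⨯ A) :=
  Over.mk (prod.lift P.d₀ P.d₁)

/-- Two maps `f, g : A ⟶ B` are homotopic if there is a homotopy `h : A ⟶ PB` from `f` to `g`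
for some path object `PB` of `B`. -/
def Homotopic {A B : E} (f g : A ⟶ B) : Prop :=
  ∃ (P : PathObject B) (h : A ⟶ P.obj), h ≫ P.d₀ = f ∧ h ≫ P.d₁ = g

/-- A homotopy equivalence is a map with a two-sided homotopy inverse. -/
def IsHomotopyEquiv {A B : E} (f : A ⟶ B) : Prop :=
  ∃ g : B ⟶ A, Homotopic (f ≫ g) (𝟙 A) ∧ Homotopic (g ≫ f) (𝟙 B)

/-- `A` is contractible if `A ⟶ 1` is a homotopy equivalence. -/
def IsContractible (A : E) : Prop :=
  IsHomotopyEquiv (terminal.from A)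

/-- `A` is inhabited if it has an element `1 ⟶ A`. -/
def IsInhabited (A : E) : Prop :=
  Nonempty (⊤_ E ⟶ A)

/-- A commutative square with `u : C ⟶ A`, `g : C ⟶ D`, `f : A ⟶ B`, `w : D ⟶ B` is homotopy
cartesian if, for some factorization of `w` as a homotopy equivalence `w₀ : D ⟶ D'` followed by a
fibration `w₁ : D' ⟶ B`, the map `(u, w₀ g) : C ⟶ A ×_B D'` is a homotopy equivalence. -/
def IsHomotopyCartesian {A B C D : E} {g : C ⟶ D} {u : C ⟶ A} {w : D ⟶ B} {f : A ⟶ B}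
    (sq : CommSq g u w f) : Prop :=
  ∃ (D' : E) (w₀ : D ⟶ D') (w₁ : D' ⟶ B) (hw : w₀ ≫ w₁ = w),
    IsHomotopyEquiv w₀ ∧ fib w₁ ∧
    ∃ (Q : E) (q₁ : Q ⟶ A) (q₂ : Q ⟶ D') (hQ : IsPullback q₁ q₂ f w₁),
      IsHomotopyEquiv (hQ.lift u (g ≫ w₀) (by rw [Category.assoc, hw, sq.w]))

/-- A map `u : A ⟶ B` is a homotopy monomorphism if the square with sides `1_A, 1_A, u, u` is
homotopy cartesian. -/
def IsHomotopyMono {A B : E} (u : A ⟶ B) : Prop :=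
  IsHomotopyCartesian (CommSq.mk (f := 𝟙 A) (g := 𝟙 A) (h := u) (i := u) rfl)

/-- `A` is a mere proposition if `A ⟶ 1` is a homotopy monomorphism. -/
def IsMereProposition (A : E) : Prop :=
  IsHomotopyMono (terminal.from A)

/-- The choices that determine the object `isCont(A) = Σ_A Π_{p₁} (PA)`: a path object `PA` for `A`,
and an internal product of `(∂₀, ∂₁) : PA ⟶ A × A` along the first projection `p₁ : A × A ⟶ A`. -/
structure IsContData (A : E) where
  path : PathObject A
  dprod : InternalProduct (fib_fst A A) path.over

/-- The object `isCont(A) = Σ_A Π_{p₁} (PA)`. -/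
def IsContData.isCont {A : E} (K : IsContData A) : E :=
  (Over.forget A).obj K.dprod.obj

end Homotopy

end Tribes

/-!
Write `C` for `isCont A`, with its fibration `q : C ⟶ A`. By cofreeness of `Π_{p₁} (PA)`, a map
`g : X ⟶ C` with `g ≫ q = a` is the same thing as a map `k : X ⨯ A ⟶ PA` from `fst ≫ a` to `snd`,
that is, a homotopy contracting `A` onto `a`, depending on a parameter in `X`.

With `X = 1` this says that an element of `C` is a point of `A` together with a homotopy from the
constant map at this point to the identity, whence the equivalence between contractibility of `A`
and inhabitation of `C`.

For `C` to be a mere proposition it suffices that the diagonal of `C` be a homotopy equivalence, and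
for this that any two maps `f, g : X ⟶ C` be homotopic (`IsContData.homotopic`). Transporting `g`
along a path in the base `A` (`exists_homotopic_of_fib`), one reduces to the case where `f` and `g`
lie over the same map `X ⟶ A`, so that they correspond to two maps `X ⨯ A ⟶ PA` with the same
endpoints. The contraction `h` corresponding to `f` shows that every path `p` from `y` to `z` is
homotopic, relative to its endpoints, to `h(y)⁻¹ h(z)`, by path induction on `p`; hence the two maps
are fibrewise homotopic over `A ⨯ A` (`exists_fibrewise_homotopy_of_contraction`). Function
extensionality, in the form `homotopic_of_internalProduct`, turns this into a homotopy between `f`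
and `g`. It holds because the internal product functor preserves the anodyne map of constant paths,
and two maps which agree along an anodyne map are homotopic (`Anodyne.homotopic`).
-/

namespace Tribes

open Clan

variable {E : Type u} [Category.{v} E] [HasTerminal E] [Clan E]

attribute [local simp] prod.lift_fst prod.lift_snd prod.lift_fst_assoc prod.lift_snd_assoc

/-! ### Anodyne maps and fibrations -/

theorem Anodyne.exists_lift {U V Z W : E} {i : U ⟶ V} (hi : Anodyne i) {p : Z ⟶ W} (hp : fib p)
    {s : U ⟶ Z} {t : V ⟶ W} (w : s ≫ p = i ≫ t) : ∃ l : V ⟶ Z, i ≫ l = s ∧ l ≫ p = t :=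
  have := hi p hp
  have sq : CommSq s i p t := ⟨w⟩
  ⟨sq.lift, sq.fac_left, sq.fac_right⟩

theorem exists_isPullback {A X B : E} (f : A ⟶ B) {p : X ⟶ B} (hp : fib p) :
    ∃ (Q : E) (q₁ : Q ⟶ A) (q₂ : Q ⟶ X), IsPullback q₁ q₂ f p :=
  have : HasPullback f p := carrable hp f
  ⟨_, _, _, IsPullback.of_hasPullback f p⟩

theorem fib_snd (A B : E) : fib (prod.snd : A ⨯ B ⟶ B) :=
  fib_baseChange (IsPullback.of_hasBinaryProduct' A B).flip (fib_terminal A)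

theorem Anodyne.prod_map_id [IsTribe E] {U V : E} {i : U ⟶ V} (hi : Anodyne i) (X : E) :
    Anodyne (prod.map i (𝟙 X)) :=
  IsTribe.anodyne_baseChange (IsPullback.of_prod_fst_with_id i X).flip (fib_fst V X) hi

/-- If `s` is an anodyne section of `k`, then so is its base change along a fibration `q`. -/
theorem Anodyne.baseChange_section [IsTribe E] {Y D A Z : E} {z₁ : Z ⟶ Y} {z₂ : Z ⟶ D} {q : Y ⟶ A}
    {k : D ⟶ A} {s : A ⟶ D} (hs : Anodyne s) (hsk : s ≫ k = 𝟙 A) (hq : fib q)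
    (hZ : IsPullback z₁ z₂ q k) :
    Anodyne (hZ.lift (𝟙 Y) (q ≫ s) (by simp [hsk])) := by
  refine IsTribe.anodyne_baseChange ?_ (fib_baseChange hZ.flip hq) hs (p' := q)
  refine IsPullback.of_right (h₁₂ := z₁) (v₁₃ := q) (h₂₂ := k) ?_ (by simp) hZ
  simpa [hsk] using IsPullback.id_horiz q

theorem LocalAnodyne.of_anodyne {B : E} {X Y : LocalClan B} {u : X ⟶ Y}
    (hu : Anodyne u.hom.left) : LocalAnodyne u := by
  intro Z W p hp
  refine ⟨fun {s t} sq => ?_⟩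
  obtain ⟨l, h₁, h₂⟩ := hu.exists_lift hp (s := s.hom.left) (t := t.hom.left)
    (congrArg (fun m => m.hom.left) sq.w)
  have hl : l ≫ Z.obj.hom = Y.obj.hom := by
    rw [← Over.w p.hom, ← Category.assoc, h₂, Over.w]
  exact ⟨⟨⟨ObjectProperty.homMk (Over.homMk l hl), by ext; exact h₁, by ext; exact h₂⟩⟩⟩

/-- A lifting problem in `E` against a fibration `p` pulls back, along its bottom map, to one
in `E(B)`. -/
theorem LocalAnodyne.anodyne {B : E} {X Y : LocalClan B} {u : X ⟶ Y} (hu : LocalAnodyne u) :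
    Anodyne u.hom.left := by
  intro Z W p hp
  refine ⟨fun {s t} sq => ?_⟩
  obtain ⟨Q, q₁, q₂, hQ⟩ := exists_isPullback t hp
  have hq := fib_baseChange hQ hp
  let Q' : LocalClan B := ⟨Over.mk (q₁ ≫ Y.obj.hom), fib_comp _ _ hq Y.property⟩
  let r : Q' ⟶ Y := ObjectProperty.homMk (Over.homMk q₁ rfl)
  let j : X ⟶ Q' := ObjectProperty.homMk
    (Over.homMk (hQ.lift u.hom.left s sq.w.symm) (by simp [Q']))
  have := hu r hq
  have sq' : CommSq j u r (𝟙 Y) := ⟨by ext; simp [j, r]⟩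
  have h₁ : u.hom.left ≫ sq'.lift.hom.left = hQ.lift u.hom.left s sq.w.symm :=
    congrArg (fun m => m.hom.left) sq'.fac_left
  have h₂ : sq'.lift.hom.left ≫ q₁ = 𝟙 _ := congrArg (fun m => m.hom.left) sq'.fac_right
  refine ⟨⟨⟨sq'.lift.hom.left ≫ q₂, ?_, ?_⟩⟩⟩
  · rw [reassoc_of% h₁, hQ.lift_snd]
  · rw [Category.assoc, ← hQ.w, reassoc_of% h₂]

/-! ### Homotopies -/

namespace PathObject

variable {A : E} (P : PathObject A)

theorem σ_d₀ : P.σ ≫ P.d₀ = 𝟙 A := by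
  simpa using P.fac =≫ prod.fst

theorem σ_d₁ : P.σ ≫ P.d₁ = 𝟙 A := by
  simpa using P.fac =≫ prod.snd

theorem fib_d₀ : fib P.d₀ := by
  simpa using fib_comp _ _ P.fib_lift (fib_fst A A)

theorem exists_lift {U V : E} {i : U ⟶ V} (hi : Anodyne i) {φ : U ⟶ P.obj} {y z : V ⟶ A}
    (h₀ : φ ≫ P.d₀ = i ≫ y) (h₁ : φ ≫ P.d₁ = i ≫ z) :
    ∃ Φ : V ⟶ P.obj, i ≫ Φ = φ ∧ Φ ≫ P.d₀ = y ∧ Φ ≫ P.d₁ = z := by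
  obtain ⟨l, hl₁, hl₂⟩ := hi.exists_lift P.fib_lift (s := φ) (t := prod.lift y z)
    (by ext <;> simp [h₀, h₁])
  exact ⟨l, hl₁, by simpa using hl₂ =≫ prod.fst, by simpa using hl₂ =≫ prod.snd⟩

theorem nonempty [IsTribe E] (A : E) : Nonempty (PathObject A) := by
  obtain ⟨Z, i, p, h, hi, hp⟩ := IsTribe.factor (prod.lift (𝟙 A) (𝟙 A))
  have hp' : prod.lift (p ≫ prod.fst) (p ≫ prod.snd) = p := by ext <;> simp
  exact ⟨⟨Z, p ≫ prod.fst, p ≫ prod.snd, i, by rw [hp', h], hi, by rwa [hp']⟩⟩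

/-- The operation sending two paths `p : y ⟶ u` and `q : y ⟶ z` with the same source to the path
`p⁻¹ q : u ⟶ z`. It takes two constant paths to a constant path. -/
theorem exists_inv_comp [IsTribe E] {Z : E} {z₁ z₂ : Z ⟶ P.obj} (hZ : IsPullback z₁ z₂ P.d₀ P.d₀) :
    ∃ c : Z ⟶ P.obj, c ≫ P.d₀ = z₁ ≫ P.d₁ ∧ c ≫ P.d₁ = z₂ ≫ P.d₁ ∧
      ∀ (T : E) (s : T ⟶ Z) (a : T ⟶ A), s ≫ z₁ = a ≫ P.σ → s ≫ z₂ = a ≫ P.σ →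
        s ≫ c = a ≫ P.σ := by
  -- The pairs whose first path is constant form an anodyne subobject, on which `p⁻¹ q = q`.
  have hj := P.anodyne_σ.baseChange_section P.σ_d₀ P.fib_d₀ hZ.flip
  obtain ⟨c, hc, h₀, h₁⟩ := P.exists_lift hj (φ := 𝟙 _) (y := z₁ ≫ P.d₁) (z := z₂ ≫ P.d₁)
    (by simp [σ_d₁]) (by simp)
  refine ⟨c, h₀, h₁, fun T s a hs₁ hs₂ => ?_⟩
  have : s = (a ≫ P.σ) ≫ hZ.flip.lift (𝟙 _) (P.d₀ ≫ P.σ) (by simp [σ_d₀]) :=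
    hZ.hom_ext (by simp [hs₁, reassoc_of% P.σ_d₀]) (by simp [hs₂])
  rw [this, Category.assoc, hc, Category.comp_id]

end PathObject

namespace Homotopic

/-- Whether two maps are homotopic does not depend on the path object. -/
theorem exists_homotopy {X A : E} {f g : X ⟶ A} (H : Homotopic f g) (P : PathObject A) :
    ∃ h : X ⟶ P.obj, h ≫ P.d₀ = f ∧ h ≫ P.d₁ = g := by
  obtain ⟨P', h, rfl, rfl⟩ := H
  obtain ⟨l, -, h₀, h₁⟩ := P.exists_lift P'.anodyne_σ (φ := P.σ) (y := P'.d₀) (z := P'.d₁)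
    (by rw [P.σ_d₀, P'.σ_d₀]) (by rw [P.σ_d₁, P'.σ_d₁])
  exact ⟨h ≫ l, by simp [h₀], by simp [h₁]⟩

theorem precomp {X Y A : E} {f g : X ⟶ A} (H : Homotopic f g) (k : Y ⟶ X) :
    Homotopic (k ≫ f) (k ≫ g) := by
  obtain ⟨P, h, rfl, rfl⟩ := H
  exact ⟨P, k ≫ h, by simp, by simp⟩

end Homotopic

theorem Anodyne.homotopic [IsTribe E] {U V A : E} {i : U ⟶ V} (hi : Anodyne i) {f g : V ⟶ A}
    (h : i ≫ f = i ≫ g) : Homotopic f g := by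
  obtain ⟨P⟩ := PathObject.nonempty A
  obtain ⟨l, -, h₀, h₁⟩ := P.exists_lift hi (φ := i ≫ f ≫ P.σ) (y := f) (z := g)
    (by simp [P.σ_d₀]) (by simp [P.σ_d₁, h])
  exact ⟨P, l, h₀, h₁⟩

namespace Homotopic

variable [IsTribe E]

theorem refl {X A : E} (f : X ⟶ A) : Homotopic f f := by
  obtain ⟨P⟩ := PathObject.nonempty A
  exact ⟨P, f ≫ P.σ, by simp [P.σ_d₀], by simp [P.σ_d₁]⟩

theorem euclidean {X A : E} {f g k : X ⟶ A} (h : Homotopic f g) (h' : Homotopic f k) :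
    Homotopic g k := by
  obtain ⟨P⟩ := PathObject.nonempty A
  obtain ⟨p, hp₀, rfl⟩ := h.exists_homotopy P
  obtain ⟨p', hp'₀, rfl⟩ := h'.exists_homotopy P
  obtain ⟨Z, z₁, z₂, hZ⟩ := exists_isPullback P.d₀ P.fib_d₀
  obtain ⟨c, h₀, h₁, -⟩ := P.exists_inv_comp hZ
  exact ⟨P, hZ.lift p p' (hp₀.trans hp'₀.symm) ≫ c, by simp [h₀], by simp [h₁]⟩

theorem symm {X A : E} {f g : X ⟶ A} (h : Homotopic f g) : Homotopic g f :=
  h.euclidean (refl f)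

theorem trans {X A : E} {f g k : X ⟶ A} (h : Homotopic f g) (h' : Homotopic g k) :
    Homotopic f k :=
  h.symm.euclidean h'

theorem prod_lift {X A B : E} {f g : X ⟶ A} (H : Homotopic f g) (u : X ⟶ B) :
    Homotopic (prod.lift f u) (prod.lift g u) := by
  obtain ⟨P, h, rfl, rfl⟩ := H
  have key : Homotopic (prod.map P.d₀ (𝟙 B)) (prod.map P.d₁ (𝟙 B)) :=
    (P.anodyne_σ.prod_map_id B).homotopic (by simp [P.σ_d₀, P.σ_d₁])
  simpa using key.precomp (prod.lift h u)

end Homotopic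

/-- Path lifting: a map into the total object of a fibration `q` can be transported along a homotopy
in the base. -/
theorem exists_homotopic_of_fib [IsTribe E] {X Y A : E} {q : Y ⟶ A} (hq : fib q) {g : X ⟶ Y}
    {b : X ⟶ A} (H : Homotopic (g ≫ q) b) : ∃ g' : X ⟶ Y, Homotopic g g' ∧ g' ≫ q = b := by
  obtain ⟨P, h, h₀, rfl⟩ := H
  obtain ⟨Z, z₁, z₂, hZ⟩ := exists_isPullback q P.fib_d₀
  have hj := P.anodyne_σ.baseChange_section P.σ_d₀ hq hZ
  -- The transport operation, which is the identity along constant paths.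
  obtain ⟨t, ht, htq⟩ := hj.exists_lift hq (s := 𝟙 Y) (t := z₂ ≫ P.d₁) (by simp [P.σ_d₁])
  have key : Homotopic z₁ t := hj.homotopic (by rw [ht, hZ.lift_fst])
  refine ⟨hZ.lift g h h₀.symm ≫ t, ?_, by simp [htq]⟩
  simpa using key.precomp (hZ.lift g h h₀.symm)

theorem isMereProposition_of_homotopic [IsTribe E] {C : E}
    (h : ∀ (X : E) (f g : X ⟶ C), Homotopic f g) : IsMereProposition C :=
  ⟨C, 𝟙 C, terminal.from C, Category.id_comp _, ⟨𝟙 C, h _ _ _, h _ _ _⟩, fib_terminal C,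
    C ⨯ C, prod.fst, prod.snd, IsPullback.of_hasBinaryProduct' C C, prod.snd, h _ _ _, by
      have key := (h (C ⨯ C) prod.snd prod.fst).prod_lift prod.snd
      convert key using 1
      · apply (IsPullback.of_hasBinaryProduct' C C).hom_ext <;> simp
      · ext <;> simp⟩

/-! ### Fibrewise homotopies -/

/-- A fibrewise path object for a fibration `w : Y ⟶ B`: an object over `B`, with an anodyne map `r`
from `Y` and maps `e₀, e₁` to `Y` over `B`, such that `r` followed by `(e₀, e₁)` is the diagonal of
`Y` over `B`. That `(e₀, e₁)` is a fibration to `Y ×_B Y` is recorded by its right lifting property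
with respect to the anodyne maps. -/
structure FibrewisePathObject {Y B : E} (w : Y ⟶ B) where
  /-- the object of fibrewise paths -/
  obj : E
  /-- the source -/
  e₀ : obj ⟶ Y
  /-- the target -/
  e₁ : obj ⟶ Y
  /-- the constant path map -/
  r : Y ⟶ obj
  r_e₀ : r ≫ e₀ = 𝟙 Y
  r_e₁ : r ≫ e₁ = 𝟙 Y
  w_eq : e₀ ≫ w = e₁ ≫ w
  anodyne_r : Anodyne r
  fib_e₀ : fib e₀
  exists_lift : ∀ {U V : E} {i : U ⟶ V}, Anodyne i → ∀ {φ : U ⟶ obj} {y z : V ⟶ Y},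
    y ≫ w = z ≫ w → φ ≫ e₀ = i ≫ y → φ ≫ e₁ = i ≫ z →
      ∃ Φ : V ⟶ obj, i ≫ Φ = φ ∧ Φ ≫ e₀ = y ∧ Φ ≫ e₁ = z

theorem FibrewisePathObject.nonempty [IsTribe E] {Y B : E} {w : Y ⟶ B} (hw : fib w) :
    Nonempty (FibrewisePathObject w) := by
  obtain ⟨Q, q₁, q₂, hQ⟩ := exists_isPullback w hw
  obtain ⟨Z, r, p, hrp, hr, hp⟩ := IsTribe.factor (hQ.lift (𝟙 Y) (𝟙 Y) rfl)
  refine ⟨⟨Z, p ≫ q₁, p ≫ q₂, r, ?_, ?_, by simp [hQ.w], hr,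
    fib_comp _ _ hp (fib_baseChange hQ hw), ?_⟩⟩
  · rw [reassoc_of% hrp, hQ.lift_fst]
  · rw [reassoc_of% hrp, hQ.lift_snd]
  · intro U V i hi φ y z hyz h₀ h₁
    obtain ⟨l, hl₀, hl⟩ := hi.exists_lift hp (s := φ) (t := hQ.lift y z hyz)
      (hQ.hom_ext (by simpa using h₀) (by simpa using h₁))
    exact ⟨l, hl₀, by simp [reassoc_of% hl], by simp [reassoc_of% hl]⟩

/-- If `h` contracts `A` onto `a`, with a parameter in `X`, then all the maps `k` with the same
endpoints as `h` are fibrewise homotopic to a single one, namely `h(a)⁻¹ h(y)`. -/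
theorem exists_fibrewise_homotopy_of_contraction [IsTribe E] {A X : E} (P : PathObject A)
    (F : FibrewisePathObject (prod.lift P.d₀ P.d₁)) {a : X ⟶ A} {h : X ⨯ A ⟶ P.obj}
    (h₀ : h ≫ P.d₀ = prod.fst ≫ a) (h₁ : h ≫ P.d₁ = prod.snd) :
    ∃ m : X ⨯ A ⟶ P.obj, m ≫ P.d₀ = prod.fst ≫ a ∧ m ≫ P.d₁ = prod.snd ∧
      ∀ k : X ⨯ A ⟶ P.obj, k ≫ P.d₀ = prod.fst ≫ a → k ≫ P.d₁ = prod.snd →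
        ∃ K : X ⨯ A ⟶ F.obj, K ≫ F.e₀ = k ∧ K ≫ F.e₁ = m := by
  obtain ⟨Z, z₁, z₂, hZ⟩ := exists_isPullback P.d₀ P.fib_d₀
  obtain ⟨c, hc₀, hc₁, hcσ⟩ := P.exists_inv_comp hZ
  -- The homotopy from the constant path at the target of `p` to `p⁻¹ p`, by induction on `p`.
  obtain ⟨D, -, hD₀, hD₁⟩ := F.exists_lift P.anodyne_σ (φ := P.σ ≫ F.r) (y := P.d₁ ≫ P.σ)
    (z := hZ.lift (𝟙 _) (𝟙 _) rfl ≫ c) (by ext <;> simp [P.σ_d₀, P.σ_d₁, hc₀, hc₁])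
    (by simp [F.r_e₀, reassoc_of% P.σ_d₁]) (by
      rw [Category.assoc, F.r_e₁, Category.comp_id, ← Category.assoc]
      simpa using (hcσ A (P.σ ≫ hZ.lift (𝟙 _) (𝟙 _) rfl) (𝟙 A) (by simp) (by simp)).symm)
  -- `W` consists of the parameters `x : X` together with a path `p : y ⟶ z` in `A`.
  obtain ⟨W, w₁, w₂, hW⟩ := exists_isPullback (prod.snd : X ⨯ A ⟶ A) P.fib_d₀
  have hj := P.anodyne_σ.baseChange_section P.σ_d₀ (fib_snd X A) hW
  have hw : w₁ ≫ prod.snd = w₂ ≫ P.d₀ := hW.w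
  -- The pair of paths `h(y)` and `h(z)`, indexed by `W`.
  let s : W ⟶ Z := hZ.lift (w₁ ≫ h) (prod.lift (w₁ ≫ prod.fst) (w₂ ≫ P.d₁) ≫ h) (by simp [h₀])
  -- The homotopy from `p` to `h(y)⁻¹ h(z)`, by induction on `p`.
  obtain ⟨N, -, hN₀, hN₁⟩ := F.exists_lift hj (φ := h ≫ D) (y := w₂) (z := s ≫ c)
    (by ext <;> simp [s, hc₀, hc₁, h₁, hw])
    (by simp [hD₀, reassoc_of% h₁]) (by
      rw [Category.assoc, hD₁, ← Category.assoc, ← Category.assoc]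
      congr 1
      apply hZ.hom_ext
      · simp [s]
      · have : hW.lift (𝟙 (X ⨯ A)) (prod.snd ≫ P.σ) (by simp [P.σ_d₀]) ≫
            prod.lift (w₁ ≫ prod.fst) (w₂ ≫ P.d₁) = 𝟙 _ := by
          ext <;> simp [P.σ_d₁]
        simp [s, reassoc_of% this])
  refine ⟨hZ.lift (prod.lift prod.fst (prod.fst ≫ a) ≫ h) h (by simp [h₀]) ≫ c,
    by simp [hc₀, h₁], by simp [hc₁, h₁],
    fun k hk₀ hk₁ => ⟨hW.lift (prod.lift prod.fst (prod.fst ≫ a)) k (by simp [hk₀]) ≫ N,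
      by simp [hN₀], ?_⟩⟩
  rw [Category.assoc, hN₁, ← Category.assoc]
  congr 1
  apply hZ.hom_ext
  · simp [s]
  · have : hW.lift (prod.lift prod.fst (prod.fst ≫ a)) k (by simp [hk₀]) ≫
        prod.lift (w₁ ≫ prod.fst) (w₂ ≫ P.d₁) = 𝟙 _ := by
      ext <;> simp [hk₁]
    simp [s, reassoc_of% this]

/-! ### Internal products -/

namespace InternalProduct

variable {A B : E} {f : A ⟶ B} {hf : fib f}

theorem map_lam_ev {X : Over A} (P : InternalProduct hf X) {C : Over B}
    (t : (baseChange hf).obj C ⟶ X) : (baseChange hf).map (P.lam t) ≫ P.ev = t :=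
  ((P.cofree C).surjective t).choose_spec

theorem hom_ext {X : Over A} (P : InternalProduct hf X) {C : Over B} {g g' : C ⟶ P.obj}
    (h : (baseChange hf).map g ≫ P.ev = (baseChange hf).map g' ≫ P.ev) : g = g' :=
  (P.cofree C).injective h

theorem map_map_ev {X Y : Over A} (P : InternalProduct hf X) (Q : InternalProduct hf Y)
    (u : X ⟶ Y) : (baseChange hf).map (P.map Q u) ≫ Q.ev = P.ev ≫ u :=
  Q.map_lam_ev _

theorem lam_comp_map {X Y : Over A} (P : InternalProduct hf X) (Q : InternalProduct hf Y)
    (u : X ⟶ Y) {C : Over B} (t : (baseChange hf).obj C ⟶ X) :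
    P.lam t ≫ P.map Q u = Q.lam (t ≫ u) := by
  apply Q.hom_ext
  rw [Functor.map_comp, Category.assoc, map_map_ev, ← Category.assoc, map_lam_ev, map_lam_ev]

theorem map_comp_map {X Y : Over A} (P : InternalProduct hf X) (Q : InternalProduct hf Y)
    {u : X ⟶ Y} {v : Y ⟶ X} (h : u ≫ v = 𝟙 X) : P.map Q u ≫ Q.map P v = 𝟙 P.obj := by
  apply P.hom_ext
  rw [Functor.map_comp, Category.assoc, map_map_ev, ← Category.assoc, map_map_ev, Category.assoc, h]
  simp

/-- In a `π`-clan the structure map of every internal product of a fibration is a fibration, since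
internal products are unique up to isomorphism. -/
theorem fib_hom (hE : IsPiClan E) {X : Over A} (hX : fib X.hom) (P : InternalProduct hf X) :
    fib P.obj.hom := by
  obtain ⟨Q, hQ⟩ := hE hf X.hom hX
  have h₁ : P.map Q (𝟙 X) ≫ Q.map P (𝟙 X) = 𝟙 _ := P.map_comp_map Q (Category.comp_id _)
  have h₂ : Q.map P (𝟙 X) ≫ P.map Q (𝟙 X) = 𝟙 _ := Q.map_comp_map P (Category.comp_id _)
  have : IsIso (P.map Q (𝟙 X)).left :=
    ⟨(Q.map P (𝟙 X)).left, by rw [← Over.comp_left, h₁]; rfl, by rw [← Over.comp_left, h₂]; rfl⟩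
  rw [← Over.w (P.map Q (𝟙 X))]
  exact fib_comp _ _ (fib_of_isIso _ this) hQ

end InternalProduct

/-- Function extensionality: maps into an internal product are homotopic if their transposes `t` and
`t'` are fibrewise homotopic. -/
theorem homotopic_of_internalProduct [IsPiTribe E] {A B : E} {f : A ⟶ B} {hf : fib f} {Y : Over A}
    (hY : fib Y.hom) (P : InternalProduct hf Y) (F : FibrewisePathObject Y.hom) {C : Over B}
    {t t' : (baseChange hf).obj C ⟶ Y} {k : ((baseChange hf).obj C).left ⟶ F.obj}
    (h : k ≫ F.e₀ = t.left) (h' : k ≫ F.e₁ = t'.left) :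
    Homotopic (P.lam t).left (P.lam t').left := by
  have hE : IsPiClan E := IsPiTribe.isPiClan
  let O : Over A := Over.mk (F.e₀ ≫ Y.hom)
  have hO : fib O.hom := fib_comp _ _ F.fib_e₀ hY
  obtain ⟨Q, hQ⟩ := hE hf O.hom hO
  let ε₀ : O ⟶ Y := Over.homMk F.e₀ rfl
  let ε₁ : O ⟶ Y := Over.homMk F.e₁ F.w_eq.symm
  let ρ : Y ⟶ O := Over.homMk F.r (by simp [O, reassoc_of% F.r_e₀])
  let κ : (baseChange hf).obj C ⟶ O := Over.homMk k (by simp [O, reassoc_of% h])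
  have hP := P.fib_hom hE hY
  have hρ : Anodyne (P.map Q ρ).left :=
    (IsPiTribe.anodyne_map hf (X := ⟨Y, hY⟩) (Y := ⟨O, hO⟩) (ObjectProperty.homMk ρ) P Q hP hQ
      (LocalAnodyne.of_anodyne F.anodyne_r)).anodyne
  have key : Homotopic (Q.map P ε₀).left (Q.map P ε₁).left := by
    apply hρ.homotopic
    rw [← Over.comp_left, ← Over.comp_left,
      P.map_comp_map Q (by ext; exact F.r_e₀ : ρ ≫ ε₀ = 𝟙 Y),
      P.map_comp_map Q (by ext; exact F.r_e₁ : ρ ≫ ε₁ = 𝟙 Y)]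
  have h₀ : Q.lam κ ≫ Q.map P ε₀ = P.lam t := by
    rw [Q.lam_comp_map, (by ext; exact h : κ ≫ ε₀ = t)]
  have h₁ : Q.lam κ ≫ Q.map P ε₁ = P.lam t' := by
    rw [Q.lam_comp_map, (by ext; exact h' : κ ≫ ε₁ = t')]
  rw [← h₀, ← h₁]
  exact key.precomp (Q.lam κ).left

/-! ### The object of contractions -/

/-- The base change of `a : X ⟶ A` along the first projection `A ⨯ A ⟶ A` is `a ⨯ 1`. -/
noncomputable def baseChangeFstIso {A X : E} (a : X ⟶ A) :
    Over.mk (prod.map a (𝟙 A)) ≅ (baseChange (fib_fst A A)).obj (Over.mk a) :=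
  haveI : HasPullbacksAlong (prod.fst : A ⨯ A ⟶ A) := carrable (fib_fst A A)
  Over.isoMk (IsPullback.of_prod_fst_with_id a A).isoPullback (by simp)

namespace IsContData

variable {A : E} (K : IsContData A)

/-- The map to `isCont(A)` determined by a contraction `k` of `A` onto `a`. -/
noncomputable def ofContraction {X : E} (a : X ⟶ A) (k : X ⨯ A ⟶ K.path.obj)
    (h₀ : k ≫ K.path.d₀ = prod.fst ≫ a) (h₁ : k ≫ K.path.d₁ = prod.snd) : X ⟶ K.isCont :=
  (K.dprod.lam ((baseChangeFstIso a).inv ≫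
    (Over.homMk k (by ext <;> simp [PathObject.over, h₀, h₁]) :
      Over.mk (prod.map a (𝟙 A)) ⟶ K.path.over))).left

/-- Every map to `isCont(A)` comes from a contraction. -/
theorem exists_eq_ofContraction {X : E} (g : X ⟶ K.isCont) {a : X ⟶ A}
    (hg : g ≫ K.dprod.obj.hom = a) :
    ∃ (k : X ⨯ A ⟶ K.path.obj) (h₀ : k ≫ K.path.d₀ = prod.fst ≫ a)
      (h₁ : k ≫ K.path.d₁ = prod.snd), K.ofContraction a k h₀ h₁ = g := by
  let γ : Over.mk a ⟶ K.dprod.obj := Over.homMk g hg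
  let t : Over.mk (prod.map a (𝟙 A)) ⟶ K.path.over :=
    (baseChangeFstIso a).hom ≫ (baseChange (fib_fst A A)).map γ ≫ K.dprod.ev
  let k : X ⨯ A ⟶ K.path.obj := t.left
  have ht : k ≫ prod.lift K.path.d₀ K.path.d₁ = prod.map a (𝟙 A) := Over.w t
  refine ⟨k, by simpa using ht =≫ prod.fst, by simpa using ht =≫ prod.snd, ?_⟩
  have key : K.dprod.lam ((baseChangeFstIso a).inv ≫ t) = γ := by
    apply K.dprod.hom_ext
    rw [K.dprod.map_lam_ev]
    simp [t]
  exact congrArg (fun m => m.left) key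

theorem homotopic [IsPiTribe E] {X : E} (f g : X ⟶ K.isCont) : Homotopic f g := by
  have hP : fib K.path.over.hom := K.path.fib_lift
  have hq : fib K.dprod.obj.hom := K.dprod.fib_hom IsPiTribe.isPiClan hP
  obtain ⟨h, h₀, h₁, hf⟩ := K.exists_eq_ofContraction f rfl
  -- The contraction given by `f` provides a path from its centre to that of `g`.
  have hb : Homotopic (f ≫ K.dprod.obj.hom) (g ≫ K.dprod.obj.hom) :=
    ⟨K.path, prod.lift (𝟙 X) (g ≫ K.dprod.obj.hom) ≫ h, by simp [h₀], by simp [h₁]⟩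
  obtain ⟨g', hg', hgq⟩ := exists_homotopic_of_fib hq hb.symm
  obtain ⟨F⟩ := FibrewisePathObject.nonempty hP
  obtain ⟨m, hm₀, hm₁, hm⟩ := exists_fibrewise_homotopy_of_contraction K.path F h₀ h₁
  have key : ∀ e : X ⟶ K.isCont, e ≫ K.dprod.obj.hom = f ≫ K.dprod.obj.hom →
      Homotopic e (K.ofContraction _ m hm₀ hm₁) := by
    intro e he
    obtain ⟨k, hk₀, hk₁, rfl⟩ := K.exists_eq_ofContraction e he
    obtain ⟨k', hk'₀, hk'₁⟩ := hm k hk₀ hk₁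
    exact homotopic_of_internalProduct hP K.dprod F
      (k := (baseChangeFstIso (f ≫ K.dprod.obj.hom)).inv.left ≫ k')
      ((Category.assoc _ _ _).trans (congrArg _ hk'₀))
      ((Category.assoc _ _ _).trans (congrArg _ hk'₁))
  exact (key f rfl).trans ((hg'.trans (key g' hgq)).symm)

theorem isContractible_iff_isInhabited [IsTribe E] : IsContractible A ↔ IsInhabited K.isCont := by
  constructor
  · rintro ⟨a, ha, -⟩
    obtain ⟨h, h₀, h₁⟩ := ha.exists_homotopy K.path
    exact ⟨K.ofContraction a (prod.snd ≫ h)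
      (by rw [Category.assoc, h₀, ← Category.assoc]; congr 1; exact Subsingleton.elim _ _)
      (by rw [Category.assoc, h₁, Category.comp_id])⟩
  · rintro ⟨s⟩
    obtain ⟨k, h₀, h₁, -⟩ := K.exists_eq_ofContraction s rfl
    refine ⟨s ≫ K.dprod.obj.hom, ⟨K.path, prod.lift (terminal.from A) (𝟙 A) ≫ k, ?_, ?_⟩, ?_⟩
    · simp [h₀]
    · simp [h₁]
    · rw [Subsingleton.elim ((s ≫ K.dprod.obj.hom) ≫ terminal.from A) (𝟙 (⊤_ E))]
      exact Homotopic.refl _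

theorem nonempty [IsPiTribe E] (A : E) : Nonempty (IsContData A) := by
  obtain ⟨P⟩ := PathObject.nonempty A
  have hE : IsPiClan E := IsPiTribe.isPiClan
  obtain ⟨D, -⟩ := hE (fib_fst A A) (prod.lift P.d₀ P.d₁) P.fib_lift
  exact ⟨⟨P, D⟩⟩

end IsContData

end Tribes

theorem mainTheorem10 (E : Type u) [Category.{v} E] [HasTerminal E] [Tribes.Clan E]
    [Tribes.IsPiTribe E] (A : E) :
    Nonempty (Tribes.IsContData A) ∧
      ∀ K : Tribes.IsContData A,
        Tribes.IsMereProposition K.isCont ∧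
          (Tribes.IsContractible A ↔ Tribes.IsInhabited K.isCont) := by
  exact ⟨Tribes.IsContData.nonempty A, fun K =>
    ⟨Tribes.isMereProposition_of_homotopic fun _ => K.homotopic,
      K.isContractible_iff_isInhabited⟩⟩
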